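/- Let $K$ be a field. A (not necessarily associative or unital) $K$-algebra $(A,\circ)$ is called a Novikov algebra if $(a,b,c)=(a,c,b)$ and $a\circ(b\circ c)=b\circ(a\circ c)$ for all $a,b,c\in A$, where $(a,b,c)=a\circ(b\circ c)-(a\circ b)\circ c$ is the associator. For $n\ge 0$ let $N_n$ be the multilinear part of the free Novikov algebra over $K$ on $n$ generators, that is, the span of all products (with all bracketings) in which each of the $n$ generators occurs exactly once; $\dim_K N_n$ is the $n$-th codimension of the variety of Novikov algebras. (For $n=0$ one has $N_0=0$.) Then: 1. $\dim N_n=\binom{2n-2}{n-1}$ for every $n\ge 1$. 2. The codimension exponent $\lim_{n\to\infty}(\dim N_n)^{1/n}$ exists and equals $4$. 3. The generating function of the codimension sequence is $$\sum_{n\ge 0}(\dim N_n)\,x^n=x\,(1-4x)^{-1/2}$$ as a formal power series in $x$, where $(1-4x)^{-1/2}=\sum_{n\ge0}\binom{-1/2}{n}(-4x)^n$ is the binomial series. -/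

import Mathlib

/-- A (not necessarily associative or unital) algebra is a *Novikov algebra* if its associator
`(a, b, c) = a * (b * c) - (a * b) * c` satisfies `(a, b, c) = (a, c, b)`,
and `a * (b * c) = b * (a * c)`. -/
structure IsNovikov (A : Type*) [NonUnitalNonAssocRing A] : Prop where
  right_symm : ∀ a b c : A,
    a * (b * c) - (a * b) * c = a * (c * b) - (a * c) * b
  left_comm : ∀ a b c : A, a * (b * c) = b * (a * c)

/-- `I` is a two-sided ideal of the nonassociative `K`-algebra `K{X}`, and it contains all values
of the two Novikov identities. -/
structure IsNovikovIdeal (K X : Type*) [Field K]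
    (I : Submodule K (FreeNonUnitalNonAssocAlgebra K X)) : Prop where
  mul_left_mem : ∀ u v, v ∈ I → u * v ∈ I
  mul_right_mem : ∀ u v, u ∈ I → u * v ∈ I
  right_symm_mem : ∀ a b c,
    (a * (b * c) - (a * b) * c) - (a * (c * b) - (a * c) * b) ∈ I
  left_comm_mem : ∀ a b c, a * (b * c) - b * (a * c) ∈ I

/-- The smallest two-sided ideal of the free nonassociative algebra that contains all values of
the Novikov identities. -/
noncomputable def novikovIdeal (K X : Type*) [Field K] : Submodule K (FreeNonUnitalNonAssocAlgebra K X) :=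
  sInf {I | IsNovikovIdeal K X I}

theorem novikovIdeal_spec (K X : Type*) [Field K] :
    IsNovikovIdeal K X (novikovIdeal K X) where
  mul_left_mem u v hv := Submodule.mem_sInf.2 fun I hI =>
    hI.mul_left_mem u v (Submodule.mem_sInf.1 hv I hI)
  mul_right_mem u v hu := Submodule.mem_sInf.2 fun I hI =>
    hI.mul_right_mem u v (Submodule.mem_sInf.1 hu I hI)
  right_symm_mem a b c := Submodule.mem_sInf.2 fun _ hI => hI.right_symm_mem a b c
  left_comm_mem a b c := Submodule.mem_sInf.2 fun _ hI => hI.left_comm_mem a b c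

/-- The free Novikov algebra over the field `K` on the set `X` of generators. -/
def FreeNovikov (K X : Type*) [Field K] : Type _ :=
  FreeNonUnitalNonAssocAlgebra K X ⧸ novikovIdeal K X

namespace FreeNovikov

noncomputable section

variable (K X : Type*) [Field K]

instance : AddCommGroup (FreeNovikov K X) :=
  inferInstanceAs (AddCommGroup (FreeNonUnitalNonAssocAlgebra K X ⧸ novikovIdeal K X))

instance : Module K (FreeNovikov K X) :=
  inferInstanceAs (Module K (FreeNonUnitalNonAssocAlgebra K X ⧸ novikovIdeal K X))

/-- The quotient map, as a linear map. -/
def mk : FreeNonUnitalNonAssocAlgebra K X →ₗ[K] FreeNovikov K X := (novikovIdeal K X).mkQ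

variable {K X}

theorem mk_surjective : Function.Surjective (mk K X) := Submodule.mkQ_surjective _

theorem mk_eq_mk {u v : FreeNonUnitalNonAssocAlgebra K X} :
    mk K X u = mk K X v ↔ u - v ∈ novikovIdeal K X := Submodule.Quotient.eq _

/-- The product induced from the free nonassociative algebra. -/
instance : Mul (FreeNovikov K X) where
  mul := Quotient.map₂ (· * ·) (by
    intro u u' hu v v' hv
    refine (Submodule.quotientRel_def _).2 ?_
    replace hu := (Submodule.quotientRel_def _).1 hu
    replace hv := (Submodule.quotientRel_def _).1 hv
    have h : u * v - u' * v' = (u - u') * v + u' * (v - v') := by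
      rw [sub_mul, mul_sub]; abel
    rw [h]
    exact add_mem ((novikovIdeal_spec K X).mul_right_mem _ _ hu)
      ((novikovIdeal_spec K X).mul_left_mem _ _ hv))

theorem mk_mul (u v : FreeNonUnitalNonAssocAlgebra K X) :
    mk K X (u * v) = mk K X u * mk K X v := rfl

instance : NonUnitalNonAssocRing (FreeNovikov K X) where
  left_distrib x y z := by
    obtain ⟨u, rfl⟩ := mk_surjective x
    obtain ⟨v, rfl⟩ := mk_surjective y
    obtain ⟨w, rfl⟩ := mk_surjective z
    simp only [← map_add, ← mk_mul, mul_add]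
  right_distrib x y z := by
    obtain ⟨u, rfl⟩ := mk_surjective x
    obtain ⟨v, rfl⟩ := mk_surjective y
    obtain ⟨w, rfl⟩ := mk_surjective z
    simp only [← map_add, ← mk_mul, add_mul]
  zero_mul x := by
    obtain ⟨u, rfl⟩ := mk_surjective x
    rw [← map_zero (mk K X), ← mk_mul, zero_mul]
  mul_zero x := by
    obtain ⟨u, rfl⟩ := mk_surjective x
    rw [← map_zero (mk K X), ← mk_mul, mul_zero]

instance : IsScalarTower K (FreeNovikov K X) (FreeNovikov K X) where
  smul_assoc t x y := by
    obtain ⟨u, rfl⟩ := mk_surjective x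
    obtain ⟨v, rfl⟩ := mk_surjective y
    simp only [smul_eq_mul, ← map_smul, ← mk_mul, smul_mul_assoc]

instance : SMulCommClass K (FreeNovikov K X) (FreeNovikov K X) where
  smul_comm t x y := by
    obtain ⟨u, rfl⟩ := mk_surjective x
    obtain ⟨v, rfl⟩ := mk_surjective y
    simp only [smul_eq_mul, ← map_smul, ← mk_mul, mul_smul_comm]

theorem isNovikov : IsNovikov (FreeNovikov K X) where
  right_symm x y z := by
    obtain ⟨a, rfl⟩ := mk_surjective x
    obtain ⟨b, rfl⟩ := mk_surjective y
    obtain ⟨c, rfl⟩ := mk_surjective z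
    simp only [← mk_mul, ← map_sub]
    exact mk_eq_mk.2 ((novikovIdeal_spec K X).right_symm_mem a b c)
  left_comm x y z := by
    obtain ⟨a, rfl⟩ := mk_surjective x
    obtain ⟨b, rfl⟩ := mk_surjective y
    obtain ⟨c, rfl⟩ := mk_surjective z
    simp only [← mk_mul]
    exact mk_eq_mk.2 ((novikovIdeal_spec K X).left_comm_mem a b c)

variable (K) in
/-- The generators of the free Novikov algebra. -/
def of (x : X) : FreeNovikov K X := mk K X (FreeNonUnitalNonAssocAlgebra.of K x)

/-- The universal property of the free Novikov algebra. -/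
theorem existsUnique_lift {A : Type*} [NonUnitalNonAssocRing A] [Module K A]
    [IsScalarTower K A A] [SMulCommClass K A A] (hA : IsNovikov A) (f : X → A) :
    ∃! φ : FreeNovikov K X →ₙₐ[K] A, ∀ x, φ (of K x) = f x := by
  let F := FreeNonUnitalNonAssocAlgebra.lift K f
  have hI : IsNovikovIdeal K X (LinearMap.ker (F : _ →ₗ[K] A)) :=
    { mul_left_mem := fun u v hv => by
        have hv' : F v = 0 := hv
        change F (u * v) = 0
        rw [map_mul, hv', mul_zero]
      mul_right_mem := fun u v hu => by
        have hu' : F u = 0 := hu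
        change F (u * v) = 0
        rw [map_mul, hu', zero_mul]
      right_symm_mem := fun a b c => by
        change F _ = 0
        simp only [map_sub, map_mul]
        rw [hA.right_symm, sub_self]
      left_comm_mem := fun a b c => by
        change F _ = 0
        simp only [map_sub, map_mul]
        rw [hA.left_comm, sub_self] }
  have hle : novikovIdeal K X ≤ LinearMap.ker (F : _ →ₗ[K] A) := sInf_le hI
  let G : FreeNovikov K X →ₗ[K] A := (novikovIdeal K X).liftQ (F : _ →ₗ[K] A) hle
  have hG : ∀ u, G (mk K X u) = F u := fun u => rfl
  refine ⟨{ G with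
      map_zero' := map_zero G
      map_mul' := fun x y => ?_ }, fun x => ?_, fun ψ hψ => ?_⟩
  · obtain ⟨u, rfl⟩ := mk_surjective x
    obtain ⟨v, rfl⟩ := mk_surjective y
    change G (mk K X u * mk K X v) = G (mk K X u) * G (mk K X v)
    rw [← mk_mul, hG, hG, hG, map_mul]
  · exact (hG _).trans (FreeNonUnitalNonAssocAlgebra.lift_of_apply K f x)
  · let M : FreeNonUnitalNonAssocAlgebra K X →ₙₐ[K] FreeNovikov K X :=
      { mk K X with
        map_zero' := map_zero (mk K X)
        map_mul' := mk_mul }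
    have h : ψ.comp M = F :=
      (FreeNonUnitalNonAssocAlgebra.lift_unique K f (ψ.comp M)).1 (funext hψ)
    ext x
    obtain ⟨u, rfl⟩ := mk_surjective x
    exact DFunLike.congr_fun h u

/-- The multiset of generators occurring in a nonassociative monomial. -/
def letters : FreeMagma X → Multiset X
  | .of x => {x}
  | .mul u v => letters u + letters v

variable (K X) in
/-- The multilinear part of the free Novikov algebra on a finite set `X` of generators: the span
of the products, with all bracketings, in which each generator occurs exactly once. -/
def multilinearPart [Fintype X] : Submodule K (FreeNovikov K X) :=
  Submodule.span K (FreeMagma.lift (of K) '' {w : FreeMagma X | letters w = Finset.univ.val})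

variable (K) in
/-- The `n`-th codimension of the variety of Novikov algebras over `K`: the dimension of the
multilinear part of the free Novikov algebra on `n` generators. -/
def codimension (n : ℕ) : ℕ := Module.finrank K (multilinearPart K (Fin n))

end

end FreeNovikov

/-! The multilinear part on `n` generators is compared with the functions `k` from the generators to
`ℕ` of total `n - 1`, of which there are `(2n-2).choose (n-1)`. The model is commutative
differential algebra with `a ∘ b = a' b`: each product adds one derivation, so a product of all
generators becomes a combination of monomials `∏ x^(k x)` with such `k`.

Upper bound. The Novikov identities turn every product into a combination of normal forms `w₁ (w₂ (⋯
z))` (`lift_mem_filtration`), filtered by the number of factors `wᵢ`, that is, of differentiated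
letters. Reordering the factors or the letters changes a normal form only by terms deeper in the
filtration (`normalForm_sub_mem_of_perm`). Modulo these it depends on `k` alone. The filtration
ends, as there are only `n` letters, so one normal form for each realized `k` suffices to span.

Lower bound. The homomorphism to differential polynomials hits every monomial `∏ x^(k x)`
(`prod_X_mem_map_homogeneousPart`), and these are independent. No integer coefficient is inverted,
so the characteristic plays no role. The limit and the series then follow from facts on central
binomial coefficients. -/

namespace FreeNovikov

variable {K X : Type*} [Field K]

/-! ### Normal forms -/

theorem mul_left_comm_novikov (a b c : FreeNovikov K X) : a * (b * c) = b * (a * c) :=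
  isNovikov.left_comm a b c

theorem mul_mul_right_comm (a b c : FreeNovikov K X) :
    (a * b) * c = (a * c) * b + a * (b * c) - a * (c * b) := by
  have h := (isNovikov (K := K) (X := X)).right_symm a b c
  rw [sub_eq_sub_iff_add_eq_add] at h
  rw [eq_sub_iff_add_eq, add_comm, ← h, add_comm]

/-- The left-normed product `((w * y₁) * y₂) * ⋯` for a list `y₁, y₂, …` of generators. -/
noncomputable def leftNormed (w : FreeNovikov K X) (ys : List X) : FreeNovikov K X :=
  ys.foldl (fun u y => u * of K y) w

@[simp] theorem leftNormed_nil (w : FreeNovikov K X) : leftNormed w [] = w := rfl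

@[simp] theorem leftNormed_cons (w : FreeNovikov K X) (y : X) (ys : List X) :
    leftNormed w (y :: ys) = leftNormed (w * of K y) ys := rfl

theorem leftNormed_concat (w : FreeNovikov K X) (y : X) (ys : List X) :
    leftNormed w (ys ++ [y]) = leftNormed w ys * of K y := by
  simp [leftNormed, List.foldl_append]

theorem leftNormed_sub (v w : FreeNovikov K X) (ys : List X) :
    leftNormed (v - w) ys = leftNormed v ys - leftNormed w ys := by
  induction ys generalizing v w with
  | nil => rfl
  | cons y ys ih => simp [sub_mul, ih]

variable (K) in
/-- The normal form `w₁ * (w₂ * (⋯ * z))` in which `wᵢ` is the left-normed product of `xᵢ` with the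
next `kᵢ` letters of the list, for a list of pairs `(xᵢ, kᵢ)`. Its leading differential monomial
is the product of the `xᵢ` differentiated `kᵢ + 1` times and of the letters of the list. -/
noncomputable def normalForm : List (X × ℕ) → List X → FreeNovikov K X
  | [], [] => 0
  | [], y :: _ => of K y
  | (x, k) :: P, ys => leftNormed (of K x) (ys.take k) * normalForm P (ys.drop k)

theorem normalForm_cons (x : X) (k : ℕ) (P : List (X × ℕ)) (ys : List X) :
    normalForm K ((x, k) :: P) ys =
      leftNormed (of K x) (ys.take k) * normalForm K P (ys.drop k) := by
  simp [normalForm]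

theorem normalForm_cons_append (x : X) (P : List (X × ℕ)) (ts ys : List X) :
    normalForm K ((x, ts.length) :: P) (ts ++ ys) =
      leftNormed (of K x) ts * normalForm K P ys := by
  simp [normalForm_cons]

theorem normalForm_cons_append' (x : X) {k : ℕ} (P : List (X × ℕ)) (ts ys : List X)
    (h : ts.length = k) :
    normalForm K ((x, k) :: P) (ts ++ ys) =
      leftNormed (of K x) ts * normalForm K P ys := by
  subst h; exact normalForm_cons_append ..

/-- The list of letters has the length that the list of pairs needs to form a normal form. -/
def IsBalanced (P : List (X × ℕ)) (ys : List X) : Prop :=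
  (P.map Prod.snd).sum + 1 = ys.length

/-- The multiset of all letters of a normal form. -/
def content (P : List (X × ℕ)) (ys : List X) : Multiset X :=
  (P.map Prod.fst : Multiset X) + (ys : Multiset X)

theorem content_cons_append (x : X) (k : ℕ) (P : List (X × ℕ)) (ts ys : List X) :
    content ((x, k) :: P) (ts ++ ys) = {x} + (ts : Multiset X) + content P ys := by
  simp only [content, List.map_cons, ← Multiset.cons_coe, ← Multiset.singleton_add,
    ← Multiset.coe_add]
  abel

/-! ### The filtration by differentiated letters -/

variable (K) in
/-- The span of the normal forms with letters `S` and at least `r` differentiated letters. -/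
noncomputable def filtration (r : ℕ) (S : Multiset X) : Submodule K (FreeNovikov K X) :=
  Submodule.span K {u | ∃ P ys, r ≤ P.length ∧ IsBalanced P ys ∧ content P ys = S ∧
    normalForm K P ys = u}

theorem filtration_mono {r r' : ℕ} {S S' : Multiset X} {u : FreeNovikov K X}
    (hu : u ∈ filtration K r S) (hr : r' ≤ r) (hS : S = S') : u ∈ filtration K r' S' := by
  subst hS
  refine Submodule.span_mono ?_ hu
  rintro u ⟨P, ys, h, h'⟩
  exact ⟨P, ys, hr.trans h, h'⟩

theorem normalForm_mem {P : List (X × ℕ)} {ys : List X} (h : IsBalanced P ys) :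
    normalForm K P ys ∈ filtration K P.length (content P ys) :=
  Submodule.subset_span ⟨P, ys, le_rfl, h, rfl, rfl⟩

theorem of_mem_filtration (x : X) : of K x ∈ filtration K 0 {x} :=
  normalForm_mem (P := []) (ys := [x]) rfl

theorem leftNormed_of_mul_mem (x : X) (ts : List X) {r : ℕ} {S : Multiset X}
    {u : FreeNovikov K X} (hu : u ∈ filtration K r S) :
    leftNormed (of K x) ts * u ∈ filtration K (r + 1) ({x} + (ts : Multiset X) + S) := by
  refine Submodule.span_induction ?_ ?_ ?_ ?_ hu
  · rintro _ ⟨P, ys, hr, hb, rfl, rfl⟩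
    rw [← normalForm_cons_append]
    refine filtration_mono (normalForm_mem ?_) ?_ (content_cons_append ..)
    · simp only [IsBalanced, List.map_cons, List.sum_cons, List.length_append] at hb ⊢
      omega
    · simpa using hr
  · simp
  · intro u v _ _ hu hv
    rw [mul_add]; exact add_mem hu hv
  · intro t u _ hu
    rw [mul_smul_comm]; exact Submodule.smul_mem _ _ hu

theorem of_mul_mem (x : X) {r : ℕ} {S : Multiset X}
    {u : FreeNovikov K X} (hu : u ∈ filtration K r S) :
    of K x * u ∈ filtration K (r + 1) ({x} + S) :=
  filtration_mono (leftNormed_of_mul_mem x [] hu) le_rfl (by simp)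

theorem IsBalanced.exists_split {x : X} {k : ℕ} {P : List (X × ℕ)} {ys : List X}
    (h : IsBalanced ((x, k) :: P) ys) :
    ∃ ts zs, ys = ts ++ zs ∧ ts.length = k ∧ IsBalanced P zs := by
  simp only [IsBalanced, List.map_cons, List.sum_cons] at h
  refine ⟨ys.take k, ys.drop k, (List.take_append_drop _ _).symm, ?_, ?_⟩
  · rw [List.length_take]; omega
  · simp only [IsBalanced, List.length_drop]; omega

/-- By right symmetry `(w c) z = (w z) c + w (c z) - w (z c)`: the new letter joins the first
factor, multiplies the tail (induction), or becomes a factor of its own. With no factors, `y * z`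
differentiates `y`, hence the `max`. -/
theorem normalForm_mul_of_mem (z : X) (P : List (X × ℕ)) (ys : List X) (hb : IsBalanced P ys) :
    normalForm K P ys * of K z ∈ filtration K (max 1 P.length) (content P ys + {z}) := by
  induction P generalizing ys with
  | nil =>
    obtain ⟨y, rfl⟩ : ∃ y, ys = [y] := List.length_eq_one_iff.1 hb.symm
    exact filtration_mono (of_mul_mem y (of_mem_filtration z)) (by simp) (by simp [content])
  | cons p P ih =>
    obtain ⟨x, k⟩ := p
    obtain ⟨ts, zs, rfl, rfl, hb'⟩ := hb.exists_split
    have hc := normalForm_mem (K := K) hb'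
    rw [normalForm_cons_append, mul_mul_right_comm, ← leftNormed_concat, content_cons_append]
    refine sub_mem (add_mem ?_ ?_) ?_
    · refine filtration_mono (leftNormed_of_mul_mem x _ hc) (by simp) ?_
      rw [← Multiset.coe_add, Multiset.coe_singleton]; abel
    · refine filtration_mono (leftNormed_of_mul_mem x ts (ih zs hb')) (by simp) ?_
      abel
    · refine filtration_mono (leftNormed_of_mul_mem x ts (of_mul_mem z hc)) (by simp) ?_
      abel

theorem mul_of_mem {r : ℕ} {S : Multiset X} {u : FreeNovikov K X} (hu : u ∈ filtration K r S)
    (z : X) : u * of K z ∈ filtration K (max 1 r) (S + {z}) := by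
  refine Submodule.span_induction ?_ ?_ ?_ ?_ hu
  · rintro _ ⟨P, ys, hr, hb, rfl, rfl⟩
    exact filtration_mono (normalForm_mul_of_mem z P ys hb) (by omega) rfl
  · simp
  · intro u v _ _ hu hv
    rw [add_mul]; exact add_mem hu hv
  · intro t u _ hu
    rw [smul_mul_assoc]; exact Submodule.smul_mem _ _ hu

/-- Left commutativity pulls the factors of `v` out of the product until only its last letter
remains. A left operand is differentiated, so it contributes at least one differentiated letter even
when `r = 0`. -/
theorem mul_mem_filtration {r s : ℕ} {S T : Multiset X} {u v : FreeNovikov K X}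
    (hu : u ∈ filtration K r S) (hv : v ∈ filtration K s T) :
    u * v ∈ filtration K (max 1 r + s) (S + T) := by
  refine Submodule.span_induction ?_ ?_ ?_ ?_ hv
  · rintro _ ⟨P, ys, hs, hb, rfl, rfl⟩
    refine filtration_mono (r := max 1 r + P.length) ?_ (by omega) rfl
    clear hs hv
    induction P generalizing ys with
    | nil =>
      obtain ⟨y, rfl⟩ : ∃ y, ys = [y] := List.length_eq_one_iff.1 hb.symm
      exact filtration_mono (mul_of_mem hu y) (by simp) (by simp [content])
    | cons p P ih =>
      obtain ⟨x, k⟩ := p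
      obtain ⟨ts, zs, rfl, rfl, hb'⟩ := hb.exists_split
      rw [normalForm_cons_append, mul_left_comm_novikov, content_cons_append]
      refine filtration_mono (leftNormed_of_mul_mem x ts (ih zs hb')) ?_ (by abel)
      simp; omega
  · simp
  · intro u v _ _ hu hv
    rw [mul_add]; exact add_mem hu hv
  · intro t u _ hu
    rw [mul_smul_comm]; exact Submodule.smul_mem _ _ hu

theorem lift_mem_filtration (w : FreeMagma X) :
    FreeMagma.lift (of K) w ∈ filtration K 0 (letters w) := by
  induction w with
  | ih1 x => exact of_mem_filtration x
  | ih2 u v hu hv =>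
    rw [map_mul]
    exact filtration_mono (mul_mem_filtration hu hv) (by simp) rfl

/-! ### Independence of the order, modulo deeper terms -/

theorem leftNormed_mem_filtration {r : ℕ} {S : Multiset X} {u : FreeNovikov K X}
    (hu : u ∈ filtration K r S) (ys : List X) :
    leftNormed u ys ∈ filtration K r (S + (ys : Multiset X)) := by
  induction ys generalizing u S with
  | nil => simpa using hu
  | cons y ys ih =>
    refine filtration_mono (ih (filtration_mono (mul_of_mem hu y) (le_max_right _ _) rfl)) le_rfl ?_
    rw [← Multiset.cons_coe, ← Multiset.singleton_add]; abel

/-- Right symmetry gives `(u z) y - (u y) z = u (z y) - u (y z)`, and in both terms `u` and one more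
letter are differentiated. -/
theorem leftNormed_sub_mem_of_perm {S : Multiset X} {u : FreeNovikov K X}
    (hu : u ∈ filtration K 0 S) {ys zs : List X} (h : ys.Perm zs) :
    leftNormed u ys - leftNormed u zs ∈ filtration K 2 (S + (ys : Multiset X)) := by
  induction h generalizing u S with
  | nil => simp
  | cons y h ih =>
    refine filtration_mono (ih (filtration_mono (mul_of_mem hu y) (Nat.zero_le _) rfl)) le_rfl ?_
    rw [← Multiset.cons_coe, ← Multiset.singleton_add]; abel
  | swap y z l =>
    have hyz (y z : X) : u * (of K y * of K z) ∈ filtration K 2 (S + {y} + {z}) :=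
      filtration_mono (mul_mem_filtration hu (of_mul_mem y (of_mem_filtration z))) (by simp)
        (by abel)
    have : u * of K z * of K y - u * of K y * of K z ∈ filtration K 2 (S + {y} + {z}) := by
      rw [mul_mul_right_comm, add_sub_assoc, add_sub_cancel_left]
      exact sub_mem (filtration_mono (hyz z y) le_rfl (by abel)) (hyz y z)
    simp only [leftNormed_cons, ← leftNormed_sub]
    refine filtration_mono (leftNormed_mem_filtration this l) le_rfl ?_
    simp only [← Multiset.cons_coe, ← Multiset.singleton_add]; abel
  | trans h₁ _ ih₁ ih₂ =>
    rw [← sub_add_sub_cancel]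
    exact add_mem (ih₁ hu) (filtration_mono (ih₂ hu) le_rfl (by rw [Multiset.coe_eq_coe.2 h₁]))

/-- The exchange of `a` and `b` between two factors. On the left only `q` and `w` need be
differentiated; every term on the right forces a further differentiation, of `a`, `b` or `c`, so the
difference lies deeper in the filtration. -/
theorem mul_mul_mul_exchange (q w a b c : FreeNovikov K X) :
    (q * a) * ((w * b) * c) - (q * b) * ((w * a) * c) =
      (q * c) * (w * (b * a)) - (q * c) * (w * (a * b)) +
      ((w * b) * (q * (a * c)) - (w * a) * (q * (b * c))) +
      (q * (c * (w * (a * b))) - q * (c * (w * (b * a)))) := by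
  have h₁ (y t : FreeNovikov K X) :
      (q * y) * t = (q * t) * y + q * (y * t) - q * (t * y) := mul_mul_right_comm q y t
  have h₂ (y z : FreeNovikov K X) :
      (w * y) * ((q * z) * c) = (q * c) * ((w * y) * z) + (w * y) * (q * (z * c)) -
        q * (c * ((w * y) * z)) := by
    rw [h₁ z c, mul_sub, mul_add, mul_left_comm_novikov (w * y) (q * c),
      mul_left_comm_novikov (w * y) q (c * z), mul_left_comm_novikov (w * y) c z]
  rw [mul_left_comm_novikov (q * a), h₂ b a, mul_left_comm_novikov (q * b), h₂ a b,
    mul_mul_right_comm w a b]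
  simp only [mul_sub, mul_add]
  abel

/-- Trades the last letter of one factor for the first letter of what follows. If the next factor
has letters of its own, `mul_mul_mul_exchange` applies to it. The hypothesis on lengths says that
`P` with `b :: ys` is balanced. -/
theorem normalForm_exchange_mem {S : Multiset X} {q : FreeNovikov K X}
    (hq : q ∈ filtration K 0 S) (a b : X) (P : List (X × ℕ)) (ys : List X)
    (hl : (P.map Prod.snd).sum = ys.length) :
    (q * of K a) * normalForm K P (b :: ys) - (q * of K b) * normalForm K P (a :: ys) ∈
      filtration K (P.length + 2) (S + {a} + {b} + content P ys) := by
  induction P generalizing ys with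
  | nil =>
    obtain rfl : ys = [] := by simpa using hl.symm
    have hab (a b : X) : q * (of K a * of K b) ∈ filtration K 2 (S + {a} + {b}) :=
      filtration_mono (mul_mem_filtration hq (of_mul_mem a (of_mem_filtration b))) (by simp)
        (by abel)
    simp only [normalForm]
    rw [mul_mul_right_comm, add_sub_assoc, add_sub_cancel_left]
    refine filtration_mono (sub_mem (hab a b) (filtration_mono (hab b a) le_rfl ?_)) le_rfl ?_
    · abel
    · simp [content]
  | cons p P ih =>
    obtain ⟨x, k⟩ := p
    cases k with
    | zero =>
      -- A factor consisting of the single letter `x` takes no part in the exchange: left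
      -- commutativity moves it to the front.
      have h0 (u : FreeNovikov K X) (z : X) :
          u * normalForm K ((x, 0) :: P) (z :: ys) = of K x * (u * normalForm K P (z :: ys)) := by
        rw [normalForm_cons, mul_left_comm_novikov]; simp
      rw [h0, h0, ← mul_sub]
      refine filtration_mono (of_mul_mem x (ih ys (by simpa using hl))) (by simp) ?_
      have := content_cons_append x 0 P [] ys
      simp only [List.nil_append] at this
      rw [this, Multiset.coe_nil]; abel
    | succ k =>
      obtain ⟨ts, zs, rfl, rfl, hzs⟩ : ∃ ts zs, ys = ts ++ zs ∧ ts.length = k ∧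
          (P.map Prod.snd).sum + 1 = zs.length := by
        simp only [List.map_cons, List.sum_cons] at hl
        refine ⟨ys.take k, ys.drop k, (List.take_append_drop _ _).symm, ?_, ?_⟩
        · rw [List.length_take]; omega
        · rw [List.length_drop]; omega
      set c := normalForm K P zs
      have hc : c ∈ filtration K P.length (content P zs) := normalForm_mem hzs
      set w := leftNormed (of K x) ts
      have hw : w ∈ filtration K 0 ({x} + (ts : Multiset X)) :=
        leftNormed_mem_filtration (of_mem_filtration x) ts
      have ha (a : X) := of_mem_filtration (K := K) a
      -- The normal form has `z` first in its block, while the exchange identity needs it last; the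
      -- correction is of depth 2.
      have hd (z : X) : leftNormed (of K x) (z :: ts) - w * of K z ∈
          filtration K 2 ({x} + (ts : Multiset X) + {z}) := by
        rw [← leftNormed_concat]
        refine filtration_mono (leftNormed_sub_mem_of_perm (of_mem_filtration x)
          (List.perm_append_singleton z ts).symm) le_rfl ?_
        rw [← Multiset.cons_coe, ← Multiset.singleton_add]; abel
      have hform (z : X) : normalForm K ((x, ts.length + 1) :: P) (z :: (ts ++ zs)) =
          (w * of K z) * c + (leftNormed (of K x) (z :: ts) - w * of K z) * c := by
        rw [← add_mul, add_sub_cancel]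
        exact normalForm_cons_append x P (z :: ts) zs
      have hcont : content ((x, ts.length + 1) :: P) (ts ++ zs) =
          {x} + (ts : Multiset X) + content P zs := content_cons_append ..
      have herr (y z : X) : (q * of K y) *
          ((leftNormed (of K x) (z :: ts) - w * of K z) * c) ∈
            filtration K (P.length + 3) (S + {y} + {z} + ({x} + (ts : Multiset X) +
              content P zs)) :=
        filtration_mono (mul_mem_filtration (mul_mem_filtration hq (ha y))
          (mul_mem_filtration (hd z) hc)) (by simp; omega) (by abel)
      have h₁ (y z : X) : (q * c) * (w * (of K y * of K z)) ∈
            filtration K (P.length + 3) (S + {y} + {z} + ({x} + (ts : Multiset X) +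
              content P zs)) :=
        filtration_mono (mul_mem_filtration (mul_mem_filtration hq hc)
          (mul_mem_filtration hw (mul_mem_filtration (ha y) (ha z)))) (by simp) (by abel)
      have h₂ (y z : X) : (w * of K y) * (q * (of K z * c)) ∈
            filtration K (P.length + 3) (S + {y} + {z} + ({x} + (ts : Multiset X) +
              content P zs)) :=
        filtration_mono (mul_mem_filtration (mul_mem_filtration hw (ha y))
          (mul_mem_filtration hq (mul_mem_filtration (ha z) hc))) (by simp; omega) (by abel)
      have h₃ (y z : X) : q * (c * (w * (of K y * of K z))) ∈
            filtration K (P.length + 3) (S + {y} + {z} + ({x} + (ts : Multiset X) +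
              content P zs)) :=
        filtration_mono (mul_mem_filtration hq (mul_mem_filtration hc
          (mul_mem_filtration hw (mul_mem_filtration (ha y) (ha z))))) (by simp; omega) (by abel)
      have hsymm : S + {b} + {a} + ({x} + (ts : Multiset X) + content P zs) =
          S + {a} + {b} + ({x} + (ts : Multiset X) + content P zs) := by abel
      have g₁ := h₁ b a
      have g₂ := h₂ b a
      have g₃ := h₃ b a
      have gerr := herr b a
      rw [hsymm] at g₁ g₂ g₃ gerr
      rw [hform, hform, mul_add, mul_add, add_sub_add_comm, mul_mul_mul_exchange, hcont]
      exact add_mem (add_mem (add_mem (sub_mem g₁ (h₁ a b)) (sub_mem g₂ (h₂ a b)))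
        (sub_mem (h₃ a b) g₃)) (sub_mem (herr a b) gerr)

theorem content_congr {P Q : List (X × ℕ)} {ys zs : List X} (hP : P.Perm Q) (hy : ys.Perm zs) :
    content P ys = content Q zs := by
  simp only [content, Multiset.coe_eq_coe.2 hy, Multiset.coe_eq_coe.2 (hP.map Prod.fst)]

theorem IsBalanced.congr {P Q : List (X × ℕ)} {ys zs : List X} (h : IsBalanced P ys)
    (hP : P.Perm Q) (hy : ys.Perm zs) : IsBalanced Q zs := by
  rw [IsBalanced, ← hy.length_eq, ← (hP.map Prod.snd).sum_eq]; exact h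

/-- The two letters lie both beyond the first factor (induction), on either side of its end
(`normalForm_exchange_mem`), or both inside it (`leftNormed_sub_mem_of_perm`). -/
theorem normalForm_swap_mem (P : List (X × ℕ)) (l₁ l₂ : List X) (a b : X)
    (hb : IsBalanced P (l₁ ++ a :: b :: l₂)) :
    normalForm K P (l₁ ++ a :: b :: l₂) - normalForm K P (l₁ ++ b :: a :: l₂) ∈
      filtration K (P.length + 1) (content P (l₁ ++ a :: b :: l₂)) := by
  induction P generalizing l₁ l₂ with
  | nil => simp [IsBalanced] at hb; omega
  | cons p P ih =>
    obtain ⟨x, k⟩ := p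
    have hb' := hb
    simp only [IsBalanced, List.map_cons, List.sum_cons, List.length_append,
      List.length_cons] at hb'
    rcases lt_trichotomy k (l₁.length + 1) with hk | hk | hk
    · obtain ⟨ts, zs, rfl, rfl⟩ : ∃ ts zs, l₁ = ts ++ zs ∧ ts.length = k :=
        ⟨l₁.take k, l₁.drop k, (List.take_append_drop _ _).symm, by
          rw [List.length_take]; omega⟩
      simp only [List.append_assoc, normalForm_cons_append, content_cons_append]
      rw [← mul_sub]
      refine filtration_mono (leftNormed_of_mul_mem x ts (ih zs l₂ ?_)) (by simp) rfl
      simp only [IsBalanced, List.length_append, List.length_cons] at hb' ⊢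
      omega
    · have h (y z : X) : l₁ ++ y :: z :: l₂ = (l₁ ++ [y]) ++ z :: l₂ := by simp
      rw [h, h, normalForm_cons_append' _ _ _ _ (by simp [hk]),
        normalForm_cons_append' _ _ _ _ (by simp [hk]), leftNormed_concat, leftNormed_concat,
        content_cons_append]
      refine filtration_mono (normalForm_exchange_mem
        (leftNormed_mem_filtration (of_mem_filtration x) l₁) a b P l₂ (by omega)) (by simp) ?_
      simp only [content, ← Multiset.cons_coe, ← Multiset.singleton_add, ← Multiset.coe_add,
        Multiset.coe_nil]
      abel
    · obtain ⟨ts, zs, rfl, hts⟩ : ∃ ts zs, l₂ = ts ++ zs ∧ l₁.length + ts.length + 2 = k :=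
        ⟨l₂.take (k - l₁.length - 2), l₂.drop (k - l₁.length - 2),
          (List.take_append_drop _ _).symm, by rw [List.length_take]; omega⟩
      have h (y z : X) : l₁ ++ y :: z :: (ts ++ zs) = (l₁ ++ y :: z :: ts) ++ zs := by simp
      rw [h, h, normalForm_cons_append' _ _ _ _ (by simp; omega),
        normalForm_cons_append' _ _ _ _ (by simp; omega), ← sub_mul, content_cons_append]
      refine filtration_mono (mul_mem_filtration (leftNormed_sub_mem_of_perm (of_mem_filtration x)
        ((List.Perm.swap b a ts).append_left l₁)) (normalForm_mem ?_)) (by simp; omega) rfl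
      simp only [IsBalanced, List.length_append] at hb' ⊢
      omega

theorem normalForm_sub_mem_of_perm_right {P : List (X × ℕ)} {ys zs : List X}
    (hb : IsBalanced P ys) (h : ys.Perm zs) :
    normalForm K P ys - normalForm K P zs ∈
      filtration K (P.length + 1) (content P ys) := by
  suffices ∀ l, IsBalanced P (l ++ ys) → normalForm K P (l ++ ys) - normalForm K P (l ++ zs) ∈
      filtration K (P.length + 1) (content P (l ++ ys)) from this [] hb
  clear hb
  induction h with
  | nil => simp
  | cons y h ih =>
    intro l hb
    have := ih (l ++ [y]) (by simpa using hb)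
    simpa using this
  | swap y z t => exact fun l hb => normalForm_swap_mem P l t z y hb
  | trans h₁ h₂ ih₁ ih₂ =>
    intro l hb
    rw [← sub_add_sub_cancel]
    refine add_mem (ih₁ l hb) (filtration_mono
      (ih₂ l (hb.congr (List.Perm.refl _) (h₁.append_left l))) le_rfl ?_)
    exact (content_congr (List.Perm.refl _) (h₁.append_left l)).symm

/-- Left commutativity swaps adjacent factors exactly, but carries their blocks of letters along;
`normalForm_sub_mem_of_perm_right` restores the order of the letters. -/
theorem normalForm_sub_mem_of_perm_left {P Q : List (X × ℕ)} {ys : List X}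
    (hb : IsBalanced P ys) (h : P.Perm Q) :
    normalForm K P ys - normalForm K Q ys ∈
      filtration K (P.length + 1) (content P ys) := by
  induction h generalizing ys with
  | nil => simp
  | cons p h ih =>
    obtain ⟨x, k⟩ := p
    obtain ⟨ts, zs, rfl, rfl, hb'⟩ := hb.exists_split
    rw [normalForm_cons_append, normalForm_cons_append, ← mul_sub, content_cons_append]
    exact leftNormed_of_mul_mem x ts (ih hb')
  | swap p p' P =>
    obtain ⟨x, k⟩ := p
    obtain ⟨x', k'⟩ := p'
    obtain ⟨ts', zs, rfl, rfl, hb'⟩ := hb.exists_split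
    obtain ⟨ts, zs, rfl, rfl, hb''⟩ := hb'.exists_split
    have hp : (ts' ++ (ts ++ zs)).Perm (ts ++ (ts' ++ zs)) := by
      rw [← List.append_assoc, ← List.append_assoc]
      exact List.perm_append_comm.append_right zs
    have := normalForm_sub_mem_of_perm_right (K := K)
      (hb.congr (List.Perm.swap _ _ _) hp) hp.symm
    rw [normalForm_cons_append, normalForm_cons_append, mul_left_comm_novikov,
      ← normalForm_cons_append x', ← normalForm_cons_append x]
    exact filtration_mono this (by simp) (content_congr (List.Perm.swap _ _ _) hp.symm)
  | trans h₁ h₂ ih₁ ih₂ =>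
    rw [← sub_add_sub_cancel]
    exact add_mem (ih₁ hb) (filtration_mono (ih₂ (hb.congr h₁ (List.Perm.refl _)))
      (by rw [h₁.length_eq]) (content_congr h₁ (List.Perm.refl _)).symm)

theorem normalForm_sub_mem_of_perm {P Q : List (X × ℕ)} {ys zs : List X}
    (hb : IsBalanced P ys) (hP : P.Perm Q) (hy : ys.Perm zs) :
    normalForm K P ys - normalForm K Q zs ∈
      filtration K (P.length + 1) (content P ys) := by
  rw [← sub_add_sub_cancel]
  exact add_mem (normalForm_sub_mem_of_perm_left hb hP) (filtration_mono
    (normalForm_sub_mem_of_perm_right (hb.congr hP (List.Perm.refl _)) hy)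
    (by rw [hP.length_eq]) (content_congr hP (List.Perm.refl _)).symm)

/-! ### Exponents of derivation -/

/-- The exponent function of the leading differential monomial of a normal form: each `(x, k)`
contributes `k + 1` derivations of `x`. -/
noncomputable def derivOrder (P : List (X × ℕ)) : X →₀ ℕ :=
  (P.map fun p => Finsupp.single p.1 (p.2 + 1)).sum

theorem derivOrder_cons (p : X × ℕ) (P : List (X × ℕ)) :
    derivOrder (p :: P) = Finsupp.single p.1 (p.2 + 1) + derivOrder P := by
  simp [derivOrder]

theorem derivOrder_apply_of_notMem {P : List (X × ℕ)} {x : X} (hx : x ∉ P.map Prod.fst) :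
    derivOrder P x = 0 := by
  induction P with
  | nil => simp [derivOrder]
  | cons p P ih =>
    simp only [List.map_cons, List.mem_cons, not_or] at hx
    rw [derivOrder_cons, Finsupp.add_apply, ih hx.2, Finsupp.single_eq_of_ne hx.1]

theorem derivOrder_apply_of_mem {P : List (X × ℕ)} (hP : (P.map Prod.fst).Nodup)
    {p : X × ℕ} (hp : p ∈ P) : derivOrder P p.1 = p.2 + 1 := by
  induction P with
  | nil => simp at hp
  | cons q P ih =>
    rw [List.map_cons, List.nodup_cons] at hP
    rw [derivOrder_cons, Finsupp.add_apply]
    rcases List.mem_cons.1 hp with rfl | hp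
    · rw [derivOrder_apply_of_notMem hP.1, Finsupp.single_eq_same, add_zero]
    · have : p.1 ≠ q.1 := fun h => hP.1 (h ▸ List.mem_map_of_mem hp)
      rw [ih hP.2 hp, Finsupp.single_eq_of_ne this, zero_add]

theorem mem_iff_derivOrder {P : List (X × ℕ)} (hP : (P.map Prod.fst).Nodup) (p : X × ℕ) :
    p ∈ P ↔ derivOrder P p.1 = p.2 + 1 := by
  refine ⟨derivOrder_apply_of_mem hP, fun h => ?_⟩
  have hmem : p.1 ∈ P.map Prod.fst := by
    by_contra hn
    rw [derivOrder_apply_of_notMem hn] at h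
    omega
  obtain ⟨q, hq, hqp⟩ := List.mem_map.1 hmem
  have h' := derivOrder_apply_of_mem hP hq
  rw [hqp, h] at h'
  have : q = p := Prod.ext hqp (by omega)
  exact this ▸ hq

theorem mem_map_fst_iff_derivOrder {P : List (X × ℕ)} (hP : (P.map Prod.fst).Nodup) (x : X) :
    x ∈ P.map Prod.fst ↔ derivOrder P x ≠ 0 := by
  refine ⟨fun h => ?_, fun h => not_imp_comm.1 derivOrder_apply_of_notMem h⟩
  obtain ⟨p, hp, rfl⟩ := List.mem_map.1 h
  rw [derivOrder_apply_of_mem hP hp]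
  omega

/-! ### The upper bound -/

section Multilinear

variable [Fintype X]

theorem nodup_of_content {P : List (X × ℕ)} {ys : List X}
    (h : content P ys = Finset.univ.val) : (P.map Prod.fst ++ ys).Nodup := by
  rw [← Multiset.coe_nodup, ← Multiset.coe_add]
  change (content P ys).Nodup
  exact h ▸ Finset.univ.nodup

theorem mem_iff_of_content {P : List (X × ℕ)} {ys : List X}
    (h : content P ys = Finset.univ.val) (x : X) : x ∈ ys ↔ derivOrder P x = 0 := by
  have hn := List.nodup_append.1 (nodup_of_content h)
  have hx : x ∈ content P ys := h ▸ Finset.mem_univ x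
  simp only [content, Multiset.mem_add, Multiset.mem_coe] at hx
  have := mem_map_fst_iff_derivOrder hn.1 x
  constructor
  · intro hy
    by_contra h0
    exact hn.2.2 x (this.2 h0) x hy rfl
  · intro h0
    exact hx.resolve_left fun h' => this.1 h' h0

/-- Since each generator occurs once, the nonzero exponents recover the pairs and the zeros recover
the letters. -/
theorem perm_of_derivOrder_eq {P Q : List (X × ℕ)} {ys zs : List X}
    (hP : content P ys = Finset.univ.val) (hQ : content Q zs = Finset.univ.val)
    (h : derivOrder P = derivOrder Q) : P.Perm Q ∧ ys.Perm zs := by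
  have hp := List.nodup_append.1 (nodup_of_content hP)
  have hq := List.nodup_append.1 (nodup_of_content hQ)
  constructor
  · rw [List.perm_ext_iff_of_nodup hp.1.of_map hq.1.of_map]
    intro p
    rw [mem_iff_derivOrder hp.1, mem_iff_derivOrder hq.1, h]
  · rw [List.perm_ext_iff_of_nodup hp.2.1 hq.2.1]
    intro x
    rw [mem_iff_of_content hP, mem_iff_of_content hQ, h]

theorem derivOrder_mem_finsuppAntidiag [DecidableEq X] {P : List (X × ℕ)} {ys : List X}
    (hb : IsBalanced P ys) (h : content P ys = Finset.univ.val) :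
    derivOrder P ∈ Finset.finsuppAntidiag (Finset.univ : Finset X) (Fintype.card X - 1) := by
  rw [Finset.mem_finsuppAntidiag]
  refine ⟨?_, Finset.subset_univ _⟩
  have hc := congrArg Multiset.card h
  have hs : ∑ x, derivOrder P x = (P.map Prod.snd).sum + P.length := by
    clear hb h hc
    induction P with
    | nil => simp [derivOrder]
    | cons p P ih =>
      simp only [derivOrder_cons, Finsupp.add_apply, Finset.sum_add_distrib, ih,
        List.map_cons, List.sum_cons, List.length_cons]
      rw [Finset.sum_eq_single p.1 (fun b _ hb => Finsupp.single_eq_of_ne hb)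
        (by simp), Finsupp.single_eq_same]
      ring
  have hc' : P.length + ys.length = Fintype.card X := by simpa [content] using hc
  rw [hs]
  rw [IsBalanced] at hb
  omega

open Classical in
variable (K) in
/-- A normal form with all generators as letters and the given exponents of derivation. -/
noncomputable def chosenNormalForm (k : X →₀ ℕ) : FreeNovikov K X :=
  if h : ∃ Py : List (X × ℕ) × List X, IsBalanced Py.1 Py.2 ∧
      content Py.1 Py.2 = Finset.univ.val ∧ derivOrder Py.1 = k then
    normalForm K h.choose.1 h.choose.2
  -- An exponent function of no normal form may get any value: only spanning is claimed.
  else 0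

theorem normalForm_sub_chosenNormalForm_mem {P : List (X × ℕ)} {ys : List X}
    (hb : IsBalanced P ys) (h : content P ys = Finset.univ.val) :
    normalForm K P ys - chosenNormalForm K (derivOrder P) ∈
      filtration K (P.length + 1) Finset.univ.val := by
  have hex : ∃ Py : List (X × ℕ) × List X, IsBalanced Py.1 Py.2 ∧
      content Py.1 Py.2 = Finset.univ.val ∧ derivOrder Py.1 = derivOrder P := ⟨(P, ys), hb, h, rfl⟩
  obtain ⟨-, h₂, h₃⟩ := hex.choose_spec
  obtain ⟨hp, hy⟩ := perm_of_derivOrder_eq h h₂ h₃.symm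
  rw [chosenNormalForm, dif_pos hex]
  exact filtration_mono (normalForm_sub_mem_of_perm hb hp hy) le_rfl h

/-- Descending induction on `r`, with `d` as fuel. Each normal form is a chosen one plus a term of
the next step, and beyond `r = Fintype.card X` there are more pairs than letters. -/
theorem filtration_le_span [DecidableEq X] (d r : ℕ) (h : Fintype.card X < r + d) :
    filtration K r (Finset.univ : Finset X).val ≤ Submodule.span K
      (chosenNormalForm K '' Finset.finsuppAntidiag (Finset.univ : Finset X)
        (Fintype.card X - 1)) := by
  induction d generalizing r with
  | zero =>
    refine Submodule.span_le.2 ?_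
    rintro _ ⟨P, ys, hr, -, hc, -⟩
    have hc' : P.length + ys.length = Fintype.card X := by
      simpa [content] using congrArg Multiset.card hc
    omega
  | succ d ih =>
    refine Submodule.span_le.2 ?_
    rintro _ ⟨P, ys, hr, hb, hc, rfl⟩
    rw [← sub_add_cancel (normalForm K P ys) (chosenNormalForm K (derivOrder P))]
    refine add_mem (ih (r + 1) (by omega) (filtration_mono
      (normalForm_sub_chosenNormalForm_mem hb hc) (by omega) rfl)) (Submodule.subset_span ?_)
    exact ⟨_, derivOrder_mem_finsuppAntidiag hb hc, rfl⟩

theorem multilinearPart_le_span [DecidableEq X] :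
    multilinearPart K X ≤ Submodule.span K
      (chosenNormalForm K '' Finset.finsuppAntidiag (Finset.univ : Finset X)
        (Fintype.card X - 1)) := by
  refine le_trans (Submodule.span_le.2 ?_) (filtration_le_span (Fintype.card X + 1) 0 (by omega))
  rintro _ ⟨w, hw, rfl⟩
  exact hw ▸ lift_mem_filtration w

-- Needed for the lower bound, where `Module.finrank` has to decrease along a linear map.
variable (K X) in
instance : FiniteDimensional K (multilinearPart K X) := by
  classical
  have h := multilinearPart_le_span (K := K) (X := X)
  rw [← Finset.coe_image] at h
  exact Submodule.finiteDimensional_of_le h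

variable (K X) in
theorem finrank_multilinearPart_le [DecidableEq X] :
    Module.finrank K (multilinearPart K X) ≤
      (Finset.finsuppAntidiag (Finset.univ : Finset X) (Fintype.card X - 1)).card := by
  classical
  have h := multilinearPart_le_span (K := K) (X := X)
  rw [← Finset.coe_image] at h
  exact (Submodule.finrank_mono h).trans
    ((finrank_span_finset_le_card _).trans Finset.card_image_le)

end Multilinear

end FreeNovikov

/-! ### The differential polynomial model -/

/-- The polynomials in the variables `x⁽ⁱ⁾`, in which the product of
`a` and `b` is the derivative of `a` times `b`. -/
def DifferentialNovikov (K X : Type*) [Field K] : Type _ := MvPolynomial (X × ℕ) K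

namespace DifferentialNovikov

variable (K X : Type*) [Field K]

/-- The derivation that takes `x⁽ⁱ⁾` to `x⁽ⁱ⁺¹⁾`. -/
noncomputable def deriv : Derivation K (MvPolynomial (X × ℕ) K) (MvPolynomial (X × ℕ) K) :=
  MvPolynomial.mkDerivation K fun p => MvPolynomial.X (p.1, p.2 + 1)

@[simp] theorem deriv_X (p : X × ℕ) :
    deriv K X (MvPolynomial.X p) = MvPolynomial.X (p.1, p.2 + 1) :=
  MvPolynomial.mkDerivation_X _ _ _

noncomputable instance : AddCommGroup (DifferentialNovikov K X) :=
  inferInstanceAs (AddCommGroup (MvPolynomial (X × ℕ) K))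

noncomputable instance : Module K (DifferentialNovikov K X) :=
  inferInstanceAs (Module K (MvPolynomial (X × ℕ) K))

/-- The identity map to the polynomials. -/
noncomputable def toPoly : DifferentialNovikov K X ≃ₗ[K] MvPolynomial (X × ℕ) K :=
  LinearEquiv.refl K (MvPolynomial (X × ℕ) K)

variable {K X}

noncomputable instance : Mul (DifferentialNovikov K X) where
  mul a b := (toPoly K X).symm (deriv K X (toPoly K X a) * toPoly K X b)

theorem toPoly_mul (a b : DifferentialNovikov K X) :
    toPoly K X (a * b) = deriv K X (toPoly K X a) * toPoly K X b := rfl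

noncomputable instance : NonUnitalNonAssocRing (DifferentialNovikov K X) where
  left_distrib a b c := (toPoly K X).injective (by simp only [toPoly_mul, map_add, mul_add])
  right_distrib a b c := (toPoly K X).injective (by simp only [toPoly_mul, map_add, add_mul])
  zero_mul a := (toPoly K X).injective (by simp only [toPoly_mul, map_zero, zero_mul])
  mul_zero a := (toPoly K X).injective (by simp only [toPoly_mul, map_zero, mul_zero])

instance : IsScalarTower K (DifferentialNovikov K X) (DifferentialNovikov K X) where
  smul_assoc t a b := (toPoly K X).injective (by
    simp only [smul_eq_mul, toPoly_mul, map_smul, Derivation.map_smul, smul_mul_assoc])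

instance : SMulCommClass K (DifferentialNovikov K X) (DifferentialNovikov K X) where
  smul_comm t a b := (toPoly K X).injective (by
    simp only [smul_eq_mul, toPoly_mul, map_smul, mul_smul_comm])

theorem isNovikov : IsNovikov (DifferentialNovikov K X) where
  right_symm a b c := (toPoly K X).injective (by
    simp only [toPoly_mul, map_sub, Derivation.leibniz, smul_eq_mul]
    ring)
  left_comm a b c := (toPoly K X).injective (by simp only [toPoly_mul]; ring)

variable (K X) in
theorem exists_linearMap : ∃ φ : FreeNovikov K X →ₗ[K] MvPolynomial (X × ℕ) K,
    (∀ x, φ (FreeNovikov.of K x) = MvPolynomial.X (x, 0)) ∧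
      ∀ u v, φ (u * v) = deriv K X (φ u) * φ v := by
  obtain ⟨ψ, hψ, -⟩ := FreeNovikov.existsUnique_lift (K := K) (X := X) isNovikov
    fun x => (toPoly K X).symm (MvPolynomial.X (x, 0))
  refine ⟨(toPoly K X).toLinearMap ∘ₗ (ψ : FreeNovikov K X →ₗ[K] DifferentialNovikov K X),
    fun x => ?_, fun u v => ?_⟩
  · exact congrArg (toPoly K X) (hψ x)
  · exact congrArg (toPoly K X) (map_mul ψ u v)

/-- By the Leibniz rule the derivative is a sum over the position of the differentiated letter, so
each position can be checked alone. -/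
theorem mul_deriv_prod_mem (W : Submodule K (MvPolynomial (X × ℕ) K)) (ts : List X)
    (q : MvPolynomial (X × ℕ) K)
    (h : ∀ l₁ y l₂, ts = l₁ ++ y :: l₂ →
      q * ((l₁.map fun x => MvPolynomial.X (x, 0)).prod * MvPolynomial.X (y, 1) *
        (l₂.map fun x => MvPolynomial.X (x, 0)).prod) ∈ W) :
    q * deriv K X (ts.map fun x => MvPolynomial.X (x, 0)).prod ∈ W := by
  induction ts generalizing q with
  | nil => simp
  | cons y ts ih =>
    rw [List.map_cons, List.prod_cons, Derivation.leibniz, mul_add, deriv_X, smul_eq_mul,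
      smul_eq_mul]
    refine add_mem ?_ ?_
    · rw [← mul_assoc]
      refine ih _ fun l₁ z l₂ hl => ?_
      have := h (y :: l₁) z l₂ (by simp [hl])
      simpa [mul_assoc] using this
    · have := h [] y ts rfl
      simpa [mul_comm] using this

end DifferentialNovikov

/-! ### The lower bound -/

namespace FreeNovikov

open DifferentialNovikov

variable {K X : Type*} [Field K]

variable (K) in
/-- The span of the products, with all bracketings, with the given multiset of letters. -/
noncomputable def homogeneousPart (S : Multiset X) : Submodule K (FreeNovikov K X) :=
  Submodule.span K (FreeMagma.lift (of K) '' {w : FreeMagma X | letters w = S})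

theorem of_mem_homogeneousPart (x : X) : of K x ∈ homogeneousPart K {x} :=
  Submodule.subset_span ⟨FreeMagma.of x, rfl, rfl⟩

theorem mul_mem_homogeneousPart {S T : Multiset X} {u v : FreeNovikov K X}
    (hu : u ∈ homogeneousPart K S) (hv : v ∈ homogeneousPart K T) :
    u * v ∈ homogeneousPart K (S + T) := by
  refine Submodule.span_induction ?_ ?_ ?_ ?_ hu
  · rintro _ ⟨w, rfl, rfl⟩
    refine Submodule.span_induction ?_ ?_ ?_ ?_ hv
    · rintro _ ⟨w', rfl, rfl⟩
      exact Submodule.subset_span ⟨w * w', rfl, map_mul _ _ _⟩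
    · simp
    · intro a b _ _ ha hb
      rw [mul_add]; exact add_mem ha hb
    · intro t a _ ha
      rw [mul_smul_comm]; exact Submodule.smul_mem _ _ ha
  · simp
  · intro a b _ _ ha hb
    rw [add_mul]; exact add_mem ha hb
  · intro t a _ ha
    rw [smul_mul_assoc]; exact Submodule.smul_mem _ _ ha

/-- The multiset of the undifferentiated variables of the letters of a list. -/
def undifferentiated (ts : List X) : Multiset (X × ℕ) := (ts : Multiset X).map fun x => (x, 0)

@[simp] theorem undifferentiated_nil : undifferentiated ([] : List X) = 0 := rfl

@[simp] theorem undifferentiated_cons (x : X) (ts : List X) :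
    undifferentiated (x :: ts) = (x, 0) ::ₘ undifferentiated ts := rfl

@[simp] theorem undifferentiated_append (l₁ l₂ : List X) :
    undifferentiated (l₁ ++ l₂) = undifferentiated l₁ + undifferentiated l₂ := by
  rw [undifferentiated, ← Multiset.coe_add, Multiset.map_add]; rfl

@[simp] theorem card_undifferentiated (ts : List X) : (undifferentiated ts).card = ts.length := by
  simp [undifferentiated]

@[simp] theorem sum_map_snd_undifferentiated (ts : List X) :
    ((undifferentiated ts).map Prod.snd).sum = 0 := by
  induction ts <;> simp_all

@[simp] theorem map_fst_undifferentiated (ts : List X) :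
    (undifferentiated ts).map Prod.fst = ts := by
  induction ts with
  | nil => rfl
  | cons x ts ih => rw [undifferentiated_cons, Multiset.map_cons, ih, Multiset.cons_coe]

@[simp] theorem filter_undifferentiated (ts : List X) :
    (undifferentiated ts).filter (fun p => p.2 = 0) = undifferentiated ts := by
  refine Multiset.filter_eq_self.2 fun p hp => ?_
  obtain ⟨x, -, rfl⟩ := Multiset.mem_map.1 hp
  rfl

@[simp] theorem prod_map_X_undifferentiated (ts : List X) :
    ((undifferentiated ts).map (MvPolynomial.X : X × ℕ → MvPolynomial (X × ℕ) K)).prod =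
      (ts.map fun x => MvPolynomial.X (x, 0)).prod := by
  induction ts <;> simp_all

/-- Each differentiated variable has order at least 1, so by counting at least `j` variables are
undifferentiated. -/
theorem exists_split_of_card {j : ℕ} {m : Multiset (X × ℕ)}
    (h : (m.map Prod.snd).sum + j ≤ m.card) :
    ∃ (ts : List X) (m' : Multiset (X × ℕ)), ts.length = j ∧
      m = undifferentiated ts + m' := by
  induction j generalizing m with
  | zero => exact ⟨[], m, rfl, by simp⟩
  | succ j ih =>
    obtain ⟨p, hp, hp0⟩ : ∃ p ∈ m, p.2 = 0 := by
      by_contra! hcon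
      have := Multiset.card_nsmul_le_sum (s := m.map Prod.snd) (a := 1) (by
        intro i hi
        obtain ⟨p, hp, rfl⟩ := Multiset.mem_map.1 hi
        exact Nat.one_le_iff_ne_zero.2 (hcon p hp))
      simp at this
      omega
    obtain ⟨m₁, rfl⟩ := Multiset.exists_cons_of_mem hp
    obtain ⟨ts, m', hts, rfl⟩ := ih (m := m₁) (by simp [hp0] at h; omega)
    refine ⟨p.1 :: ts, m', by simp [hts], ?_⟩
    rw [undifferentiated_cons, Multiset.cons_add, ← hp0]

/-- Write the monomial as `x^(j+1) t M`, with `t` a product of `j` undifferentiated letters; then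
`x^(j) t` and `M` again satisfy the weight condition. Now `x^(j+1) t M = (x^(j) t)' M - x^(j) M t'`.
The first term is the image of a product of preimages of smaller degree. The terms of the second
have the same degree but one undifferentiated variable fewer, hence the double induction on `c` and
`z`. -/
theorem prod_X_mem_map_homogeneousPart {φ : FreeNovikov K X →ₗ[K] MvPolynomial (X × ℕ) K}
    (hof : ∀ x, φ (of K x) = MvPolynomial.X (x, 0))
    (hmul : ∀ u v, φ (u * v) = deriv K X (φ u) * φ v) (c z : ℕ) (m : Multiset (X × ℕ))
    (hc : m.card = c) (hz : (m.filter fun p => p.2 = 0).card = z)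
    (hm : (m.map Prod.snd).sum + 1 = m.card) :
    (m.map MvPolynomial.X).prod ∈ (homogeneousPart K (m.map Prod.fst)).map φ := by
  induction c using Nat.strong_induction_on generalizing m z with
  | _ c ihc =>
  induction z using Nat.strong_induction_on generalizing m with
  | _ z ihz =>
  have hW {S T : Multiset X} {f g : MvPolynomial (X × ℕ) K}
      (hf : f ∈ (homogeneousPart K S).map φ) (hg : g ∈ (homogeneousPart K T).map φ) :
      deriv K X f * g ∈ (homogeneousPart K (S + T)).map φ := by
    obtain ⟨u, hu, rfl⟩ := hf
    obtain ⟨v, hv, rfl⟩ := hg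
    exact ⟨u * v, mul_mem_homogeneousPart hu hv, hmul u v⟩
  by_cases hex : ∃ p ∈ m, p.2 ≠ 0
  · obtain ⟨⟨x, j'⟩, hp, hp0⟩ := hex
    obtain ⟨j, rfl⟩ : ∃ j, j' = j + 1 := Nat.exists_eq_succ_of_ne_zero hp0
    obtain ⟨m₁, rfl⟩ := Multiset.exists_cons_of_mem hp
    have hm₁ : (m₁.map Prod.snd).sum + (j + 1) = m₁.card := by
      simp at hm; omega
    obtain ⟨ts, m₂, hts, rfl⟩ := exists_split_of_card (j := j) (m := m₁) (by omega)
    have hm₂ : (m₂.map Prod.snd).sum + 1 = m₂.card := by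
      simp [hts] at hm₁; omega
    have hcard : ts.length + m₂.card + 1 = c := by simpa using hc
    set t := (ts.map fun x => (MvPolynomial.X (x, 0) : MvPolynomial (X × ℕ) K)).prod
    set M := (m₂.map (MvPolynomial.X : X × ℕ → MvPolynomial (X × ℕ) K)).prod
    have h₂ : M ∈ (homogeneousPart K (m₂.map Prod.fst)).map φ :=
      ihc _ (by omega) _ m₂ rfl rfl hm₂
    have h₁ : MvPolynomial.X (x, j) * t ∈
        (homogeneousPart K ({x} + (ts : Multiset X))).map φ := by
      have := ihc (ts.length + 1) (by omega) _
        ((x, j) ::ₘ undifferentiated ts) (by simp) rfl (by simp [hts])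
      simpa [t, ← Multiset.singleton_add] using this
    have h₃ : (MvPolynomial.X (x, j) * M) * deriv K X t ∈
        (homogeneousPart K ({x} + (ts : Multiset X) + m₂.map Prod.fst)).map φ := by
      refine mul_deriv_prod_mem _ ts _ fun l₁ y l₂ hl => ?_
      -- If `j = 0` there is no letter to differentiate. Otherwise `(x, j)` does not add to the
      -- count of undifferentiated variables.
      have hj : j ≠ 0 := by rw [← hts, hl]; simp
      have := ihz (l₁.length + l₂.length + (m₂.filter fun p => p.2 = 0).card) (by
          rw [← hz, hl]
          simp)
        ((x, j) ::ₘ (y, 1) ::ₘ (undifferentiated l₁ +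
          undifferentiated l₂ + m₂))
        (by rw [← hcard, hl]; simp; omega)
        (by simp [hj])
        (by
          rw [hl] at hts
          simp at hts ⊢
          omega)
      have hS : ((x, j) ::ₘ (y, 1) ::ₘ (undifferentiated l₁ + undifferentiated l₂ + m₂)).map
          Prod.fst = {x} + (ts : Multiset X) + m₂.map Prod.fst := by
        rw [hl]
        simp only [Multiset.map_add, map_fst_undifferentiated,
          ← Multiset.coe_add, ← Multiset.cons_coe, ← Multiset.singleton_add, Multiset.map_singleton]
        abel
      rw [hS] at this
      convert this using 1
      simp only [M, Multiset.map_cons, Multiset.map_add, Multiset.prod_cons, Multiset.prod_add,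
        prod_map_X_undifferentiated]
      ring
    have key : (Multiset.map MvPolynomial.X
        ((x, j + 1) ::ₘ (undifferentiated ts + m₂))).prod =
        deriv K X (MvPolynomial.X (x, j) * t) * M - (MvPolynomial.X (x, j) * M) * deriv K X t := by
      simp only [M, t, Multiset.map_cons, Multiset.map_add, Multiset.prod_cons, Multiset.prod_add,
        prod_map_X_undifferentiated, Derivation.leibniz, deriv_X, smul_eq_mul]
      ring
    have hS : ((x, j + 1) ::ₘ (undifferentiated ts + m₂)).map Prod.fst =
        {x} + (ts : Multiset X) + m₂.map Prod.fst := by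
      rw [Multiset.map_cons, Multiset.map_add, map_fst_undifferentiated,
        ← Multiset.singleton_add, add_assoc]
    rw [key, hS]
    exact sub_mem (hW h₁ h₂) h₃
  · push Not at hex
    -- With nothing differentiated, the weight condition leaves a single generator.
    have h0 : (m.map Prod.snd).sum = 0 := by
      refine Multiset.sum_eq_zero fun i hi => ?_
      obtain ⟨p, hp, rfl⟩ := Multiset.mem_map.1 hi
      exact hex p hp
    obtain ⟨⟨x, j⟩, rfl⟩ := Multiset.card_eq_one.1 (by omega : m.card = 1)
    obtain rfl : j = 0 := hex (x, j) (by simp)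
    simpa using ⟨of K x, of_mem_homogeneousPart x, hof x⟩

section Multilinear

variable [Fintype X]

-- These are distinct monomials: `k x` is read off from the variable `(x, k x)` that occurs.
variable (K) in
theorem linearIndependent_prod_X :
    LinearIndependent K fun k : X →₀ ℕ =>
      ∏ x, (MvPolynomial.X (x, k x) : MvPolynomial (X × ℕ) K) := by
  classical
  have hinj : Function.Injective fun k : X →₀ ℕ =>
      ∑ x, Finsupp.single ((x, k x) : X × ℕ) 1 := by
    intro k l h
    ext x
    have := DFunLike.congr_fun h (x, k x)
    simp only [Finsupp.finsetSum_apply, Finsupp.single_apply, Prod.mk.injEq] at this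
    have hk : ∑ y, (if y = x ∧ k y = k x then 1 else 0) = 1 := by
      rw [Finset.sum_eq_single x] <;> simp +contextual
    by_contra hne
    have hl : ∑ y, (if y = x ∧ l y = k x then 1 else 0) = 0 := by
      refine Finset.sum_eq_zero fun y _ => if_neg ?_
      rintro ⟨rfl, h'⟩
      exact hne h'.symm
    omega
  have := (MvPolynomial.basisMonomials (X × ℕ) K).linearIndependent.comp _ hinj
  have heq : (fun k : X →₀ ℕ => ∏ x, (MvPolynomial.X (x, k x) : MvPolynomial (X × ℕ) K)) =
      MvPolynomial.basisMonomials (X × ℕ) K ∘ fun k => ∑ x, Finsupp.single (x, k x) 1 := by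
    funext k
    simp [MvPolynomial.X, MvPolynomial.monomial_sum_one]
  rw [heq]
  exact this

variable (K X) in
theorem le_finrank_multilinearPart [DecidableEq X] [Nonempty X] :
    (Finset.finsuppAntidiag (Finset.univ : Finset X) (Fintype.card X - 1)).card ≤
      Module.finrank K (multilinearPart K X) := by
  obtain ⟨φ, hof, hmul⟩ := exists_linearMap K X
  refine le_trans ?_ (Submodule.finrank_map_le φ (multilinearPart K X))
  have hmem (k : Finset.finsuppAntidiag (Finset.univ : Finset X) (Fintype.card X - 1)) :
      ∏ x, (MvPolynomial.X (x, k.1 x) : MvPolynomial (X × ℕ) K) ∈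
        (multilinearPart K X).map φ := by
    have hk := (Finset.mem_finsuppAntidiag.1 k.2).1
    have := prod_X_mem_map_homogeneousPart hof hmul _ _
      ((Finset.univ : Finset X).val.map fun x => (x, k.1 x)) rfl rfl (by
        -- For empty `X` the truncated `Fintype.card X - 1` would be 0, which breaks the weight
        -- condition.
        have hpos : 0 < Fintype.card X := Fintype.card_pos
        rw [Multiset.map_map]
        change ∑ x, k.1 x + 1 = _
        rw [hk]
        simp
        omega)
    simp only [Multiset.map_map, Function.comp_def, Multiset.map_id'] at this
    exact this
  have hli : LinearIndependent K fun k : Finset.finsuppAntidiag (Finset.univ : Finset X)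
      (Fintype.card X - 1) => (⟨_, hmem k⟩ : (multilinearPart K X).map φ) :=
    LinearIndependent.of_comp ((multilinearPart K X).map φ).subtype
      ((linearIndependent_prod_X K).comp Subtype.val Subtype.val_injective)
  simpa using hli.fintype_card_le_finrank

end Multilinear

/-! ### The codimensions -/

theorem codimension_succ (K : Type*) [Field K] (n : ℕ) :
    codimension K (n + 1) = n.centralBinom := by
  have h := le_antisymm (finrank_multilinearPart_le K (Fin (n + 1)))
    (le_finrank_multilinearPart K (Fin (n + 1)))
  rw [codimension, h, Finset.card_finsuppAntidiag_nat_eq_choose, Nat.centralBinom]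
  simp
  congr 1
  omega

theorem codimension_zero (K : Type*) [Field K] : codimension K 0 = 0 := by
  have h : {w : FreeMagma (Fin 0) | letters w = Finset.univ.val} = ∅ := by
    ext w
    simp only [Set.mem_ofPred_eq, Set.mem_empty_iff_false, iff_false]
    induction w with
    | ih1 x => exact x.elim0
    | ih2 u v hu _ => exact fun h => hu (Multiset.eq_zero_of_forall_notMem fun x => x.elim0)
  rw [codimension, multilinearPart, h, Set.image_empty, Submodule.span_empty, finrank_bot]

end FreeNovikov

/-! ### The binomial series and the growth rate -/

/-- Both sides are 1 at `n = 0` and have the same ratio of consecutive terms, `2 (2n + 1) / (n +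
1)`. -/
theorem ringChoose_neg_half (n : ℕ) :
    (-4 : ℚ) ^ n * Ring.choose (-1 / 2 : ℚ) n = n.centralBinom := by
  induction n with
  | zero => simp
  | succ n ih =>
    have h₁ : Ring.choose (-1 / 2 : ℚ) (n + 1) * (n + 1) =
        Ring.choose (-1 / 2 : ℚ) n * (-1 / 2 - n) := by
      rw [Ring.choose_eq_smul, Ring.choose_eq_smul, descPochhammer_succ_right]
      rw [Polynomial.smeval_mul, Polynomial.smeval_sub, Polynomial.smeval_X,
        Polynomial.smeval_natCast]
      simp [Nat.factorial_succ]
      field_simp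
    have h₂ : ((n : ℚ) + 1) * (n + 1).centralBinom = 2 * (2 * n + 1) * n.centralBinom := by
      exact_mod_cast Nat.succ_mul_centralBinom_succ n
    have hn : (n : ℚ) + 1 ≠ 0 := by positivity
    apply mul_left_cancel₀ hn
    rw [h₂, ← ih, pow_succ]
    linear_combination (-4 : ℚ) ^ n * (-4) * h₁

-- Squeeze between the `n`-th roots of `4 ^ n / (8 n)` and `4 ^ n`, using that `(8 n) ^ (1 / n)`
-- tends to 1.
open Filter Topology in
theorem tendsto_centralBinom_pred_rpow :
    Tendsto (fun n : ℕ => ((n - 1).centralBinom : ℝ) ^ (1 / (n : ℝ))) atTop (𝓝 4) := by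
  have hlow : Tendsto (fun n : ℕ => 4 * ((8 * (n : ℝ)) ^ (1 / (n : ℝ)))⁻¹) atTop (𝓝 4) := by
    have h8 : Tendsto (fun n : ℕ => (8 : ℝ) ^ (1 / (n : ℝ))) atTop (𝓝 1) := by
      have := (Real.continuous_const_rpow (a := 8) (by norm_num)).continuousAt.tendsto.comp
        (tendsto_one_div_atTop_nhds_zero_nat (𝕜 := ℝ))
      simpa [Function.comp_def] using this
    have hn : Tendsto (fun n : ℕ => (n : ℝ) ^ (1 / (n : ℝ))) atTop (𝓝 1) :=
      tendsto_rpow_div.comp tendsto_natCast_atTop_atTop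
    have h := ((h8.mul hn).inv₀ (by norm_num)).const_mul 4
    simp only [mul_one, inv_one] at h
    refine h.congr fun n => ?_
    rw [Real.mul_rpow (by norm_num) n.cast_nonneg]
  have h4 (n : ℕ) (hn : 1 ≤ n) : ((4 : ℝ) ^ n) ^ (1 / (n : ℝ)) = 4 := by
    rw [one_div, Real.pow_rpow_inv_natCast (by norm_num) (by omega)]
  refine tendsto_of_tendsto_of_tendsto_of_le_of_le' hlow tendsto_const_nhds ?_ ?_
  · filter_upwards [eventually_ge_atTop 2] with n hn
    -- From `4 ^ m ≤ 2 m * m.centralBinom` at `m = n - 1 > 0`; the shift of index turns 2 into 8.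
    have h : (4 : ℝ) ^ n ≤ 8 * n * (n - 1).centralBinom := by
      obtain ⟨m, rfl⟩ : ∃ m, n = m + 1 := ⟨n - 1, by omega⟩
      have := Nat.four_pow_le_two_mul_self_mul_centralBinom m (by omega)
      have h' : 4 ^ (m + 1) ≤ 8 * (m + 1) * m.centralBinom := by
        calc 4 ^ (m + 1) ≤ 4 * (2 * m * m.centralBinom) := by rw [pow_succ]; omega
          _ ≤ 8 * (m + 1) * m.centralBinom := by nlinarith
      exact_mod_cast h'
    have hpos : (0 : ℝ) < 8 * n := by positivity
    rw [← div_eq_mul_inv, div_le_iff₀ (by positivity)]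
    rw [← Real.mul_rpow (by positivity) (by positivity), mul_comm]
    calc (4 : ℝ) = ((4 : ℝ) ^ n) ^ (1 / (n : ℝ)) := (h4 n (by omega)).symm
      _ ≤ _ := Real.rpow_le_rpow (by positivity) h (by positivity)
  · filter_upwards [eventually_ge_atTop 1] with n hn
    calc ((n - 1).centralBinom : ℝ) ^ (1 / (n : ℝ)) ≤ ((4 : ℝ) ^ n) ^ (1 / (n : ℝ)) := by
          refine Real.rpow_le_rpow (by positivity) ?_ (by positivity)
          exact_mod_cast (Nat.centralBinom_le_four_pow _).trans
            (Nat.pow_le_pow_right (by norm_num) (by omega))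
      _ = 4 := h4 n hn

theorem theorem1p1 (K : Type*) [Field K] :
    (∀ n : ℕ, 1 ≤ n →
      FreeNovikov.codimension K n = Nat.choose (2 * n - 2) (n - 1)) ∧
    Filter.Tendsto (fun n : ℕ => (FreeNovikov.codimension K n : ℝ) ^ (1 / (n : ℝ)))
      Filter.atTop (nhds 4) ∧
    -- the second factor is the binomial series of `(1 + y) ^ (-1/2)` at `y = -4 x`
    PowerSeries.mk (fun n : ℕ => (FreeNovikov.codimension K n : ℚ)) =
      PowerSeries.X *
        PowerSeries.rescale (-4 : ℚ) (PowerSeries.binomialSeries ℚ (-1 / 2 : ℚ)) := by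
  refine ⟨fun n hn => ?_, ?_, ?_⟩
  · obtain ⟨m, rfl⟩ : ∃ m, n = m + 1 := ⟨n - 1, by omega⟩
    rw [FreeNovikov.codimension_succ, Nat.centralBinom]
    rfl
  · refine tendsto_centralBinom_pred_rpow.congr' ?_
    filter_upwards [Filter.eventually_ge_atTop 1] with n hn
    obtain ⟨m, rfl⟩ : ∃ m, n = m + 1 := ⟨n - 1, by omega⟩
    rw [FreeNovikov.codimension_succ, Nat.add_sub_cancel]
  · ext n
    cases n with
    | zero => simp [FreeNovikov.codimension_zero]
    | succ n =>
      rw [PowerSeries.coeff_succ_X_mul, PowerSeries.coeff_mk, PowerSeries.coeff_rescale,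
        PowerSeries.binomialSeries_coeff, smul_eq_mul, mul_one, ringChoose_neg_half,
        FreeNovikov.codimension_succ]
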